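/- For a lattice polytope $Q\subset\mathbb R^d$ (the convex hull of a nonempty finite subset of $\mathbb Z^d$) and $1\le n\le d$, let $L(Q)$ (respectively $L_n(Q)$) be the largest number $m$ of lattice polytopes $Q_1,\dots,Q_m$ of positive dimension whose Minkowski sum $Q_1+\dots+Q_m$ is contained in $Q$ (respectively, is contained in $Q$ and is at most $n$-dimensional); it is $0$ if there are no such polytopes. Put $\lambda(Q)=\sup_{t\ge1}L(tQ)/t$ and $\lambda_n(Q)=\sup_{t\ge 1}L_n(tQ)/t$, where $t$ runs over the positive integers. A function $f:\mathbb N\to\mathbb Q$ is a quasi-polynomial if there are an integer $k\ge1$ and polynomials $p_0,\dots,p_{k-1}\in\mathbb Q[t]$ (its constituents) with $f(t)=p_r(t)$ whenever $t\equiv r \bmod k$, $0\le r<k$; the least such $k$ is the period of $f$; $f$ is quasi-linear if its constituents have degree at most one; and a function is eventually quasi-linear with period at most $k$ if for all large $t$ it coincides with a quasi-linear function of period at most $k$. Theorem. Let $P\subset\mathbb R^d$ be a lattice polytope. The numbers $L(tP)$ ($t\in\mathbb N$) and $\lambda(P)$ are finite, and there is a least integer $k\ge1$ with $\lambda(P)=L(kP)/k$,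 called the period of $P$. The function $t\mapsto L(tP)$ is eventually quasi-linear with period at most $k$. More explicitly, there are integers $c_r$, $0\le r<k$, with $L(rP)\le c_r\le r\lambda(P)$ and $$L(tP)=k\lambda(P)\left\lfloor \frac tk\right\rfloor+c_r$$ whenever $t\equiv r\bmod k$ and $t$ is large enough. Moreover, for every $1\le n\le d$ there is an integer $k_n\ge1$ with $\lambda_n(P)=L_n(k_nP)/k_n$ such that $t\mapsto L_n(tP)$ is eventually quasi-linear with period at most $k_n$; explicitly, there are integers $c_{n,r}$, $0\le r<k_n$, with $0\le c_{n,r}\le r\lambda_n(P)$ and $L_n(tP)=k_n\lambda_n(P)\lfloor t/k_n\rfloor+c_{n,r}$ whenever $t\equiv r\bmod k_n$ and $t$ is large enough. -/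

import Mathlib

open Filter
open scoped Pointwise

noncomputable section

/-- A lattice polytope in `ℝ^d`: the convex hull of a nonempty finite set of integer points. -/
def IsLatticePolytope {d : ℕ} (P : Set (Fin d → ℝ)) : Prop :=
  ∃ V : Finset (Fin d → ℤ), V.Nonempty ∧
    P = convexHull ℝ ((fun (v : Fin d → ℤ) (i : Fin d) => (v i : ℝ)) '' (V : Set (Fin d → ℤ)))

/-- The dimension of the affine span of a nonempty set. -/
def affDim {d : ℕ} (Q : Set (Fin d → ℝ)) : ℕ := Module.finrank ℝ (vectorSpan ℝ Q)

/-- `P` contains a Minkowski sum of `m` lattice polytopes of positive dimension. -/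
def HasDecomposition {d : ℕ} (P : Set (Fin d → ℝ)) (m : ℕ) : Prop :=
  ∃ Q : Fin m → Set (Fin d → ℝ),
    (∀ i, IsLatticePolytope (Q i) ∧ 0 < affDim (Q i)) ∧ ∑ i, Q i ⊆ P

/-- `P` contains an at most `n`-dimensional Minkowski sum of `m` lattice polytopes of positive
dimension. -/
def HasDecompositionOfDim {d : ℕ} (n : ℕ) (P : Set (Fin d → ℝ)) (m : ℕ) : Prop :=
  ∃ Q : Fin m → Set (Fin d → ℝ),
    (∀ i, IsLatticePolytope (Q i) ∧ 0 < affDim (Q i)) ∧ ∑ i, Q i ⊆ P ∧ affDim (∑ i, Q i) ≤ n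

/-- The Minkowski length `L(P)`. It is `0` if `P` contains no lattice polytope of positive
dimension. -/
def minkowskiLength {d : ℕ} (P : Set (Fin d → ℝ)) : ℕ :=
  sSup {m : ℕ | HasDecomposition P m}

/-- The `n`-th Minkowski length `L_n(P)`. -/
def nthMinkowskiLength {d : ℕ} (n : ℕ) (P : Set (Fin d → ℝ)) : ℕ :=
  sSup {m : ℕ | HasDecompositionOfDim n P m}

/-- The rational Minkowski length `λ(P)`, the supremum of `L(tP) / t` over integers `t ≥ 1`. -/
def rationalMinkowskiLength {d : ℕ} (P : Set (Fin d → ℝ)) : ℝ :=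
  sSup {x : ℝ | ∃ t : ℕ, 1 ≤ t ∧ x = (minkowskiLength ((t : ℝ) • P) : ℝ) / (t : ℝ)}

/-- The `n`-th rational Minkowski length `λ_n(P)`, the supremum of `L_n(tP) / t` over integers
`t ≥ 1`. -/
def nthRationalMinkowskiLength {d : ℕ} (n : ℕ) (P : Set (Fin d → ℝ)) : ℝ :=
  sSup {x : ℝ | ∃ t : ℕ, 1 ≤ t ∧ x = (nthMinkowskiLength n ((t : ℝ) • P) : ℝ) / (t : ℝ)}

/-- `k` is the period of `P`: the least `k ≥ 1` with `λ(P) = L(kP) / k`. -/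
def IsPeriodOf {d : ℕ} (P : Set (Fin d → ℝ)) (k : ℕ) : Prop :=
  IsLeast {k : ℕ | 1 ≤ k ∧
    rationalMinkowskiLength P = (minkowskiLength ((k : ℝ) • P) : ℝ) / (k : ℝ)} k

/-- `f(t) = p_r(t)` whenever `t ≡ r` modulo `k`, `0 ≤ r < k`. -/
def HasConstituents (f : ℕ → ℚ) (k : ℕ) (p : ℕ → Polynomial ℚ) : Prop :=
  1 ≤ k ∧ ∀ r < k, ∀ t : ℕ, t ≡ r [MOD k] → f t = (p r).eval (t : ℚ)

/-- `f` is a quasi-polynomial whose period (the least possible modulus) is `k`, and its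
constituents are linear (degree at most one). -/
def IsQuasiLinearOfPeriod (f : ℕ → ℚ) (k : ℕ) : Prop :=
  IsLeast {m : ℕ | ∃ p, HasConstituents f m p} k ∧
    ∃ p, HasConstituents f k p ∧ ∀ r < k, (p r).natDegree ≤ 1

/-- `f` coincides for all large arguments with a quasi-linear function of period at most `k`. -/
def EventuallyQuasiLinear (f : ℕ → ℚ) (k : ℕ) : Prop :=
  ∃ (g : ℕ → ℚ) (k' : ℕ), IsQuasiLinearOfPeriod g k' ∧ k' ≤ k ∧ ∀ᶠ t in atTop, f t = g t

end

/-! A lattice polytope of positive dimension contains a lattice segment, so only zonotopes matter: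
multisets `s` of nonzero lattice vectors. With `tP` cut out by `0 ≤ u j y + t * h j`, the minimum of
`u j` on `a + ∑ [0, v]` is `u j a` minus the total depth of `s`, so containment is the integer
system `Fits`, and its solutions add up (`hasDecompositionOfDim_iff`, `Fits.add`).

Finitely many sets `V` of vectors suffice for all `t` at once (`exists_finite_families`). Averaging
two vectors congruent modulo 4 never increases depth, so at most one vector per residue class is
needed, and Dickson's lemma leaves finitely many choices of representatives. For fixed `V`, the
solutions `(t, a, s)` decompose into finitely many with `t ≥ 1`, up to the trivial `t = 0`, so the
best ratio of segments to `t` is attained (`exists_maximal_ratio`).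

Thus `L_n(tP)` is a maximum of finitely many superadditive sequences, each attaining its slope. For
large `t` only those of largest slope compete, so a common multiple `K` of their periods gives `F t
+ F K ≤ F (t + K)`. Along a residue class the excess over linear growth is then bounded and
eventually nondecreasing, hence eventually constant (`exists_slope_of_max_superadditive`,
`exists_eventually_eq_mul_div_add`). For `n = d` the whole sequence is superadditive, so the least
period works as well. -/

/-- The inclusion of the integer lattice into `ℝ^d`. -/
def latticeHom (d : ℕ) : (Fin d → ℤ) →+ (Fin d → ℝ) where
  toFun v i := (v i : ℝ)
  map_zero' := by ext; simp
  map_add' v w := by ext; simp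

theorem latticeHom_apply {d : ℕ} (v : Fin d → ℤ) (i : Fin d) : latticeHom d v i = (v i : ℝ) := rfl

theorem latticeHom_injective (d : ℕ) : Function.Injective (latticeHom d) := fun v w h => by
  ext i
  have := congrFun h i
  simpa [latticeHom_apply] using this

/-! ### Integer inequalities for the dilates of a lattice polytope -/

/-- **Fourier–Motzkin elimination**: a cone generated by finitely many elements of a subgroup `Λ` is
cut out by finitely many functionals with integer values on `Λ`, if the zero cone is. -/
theorem exists_finite_functionals_span {V : Type*} [AddCommGroup V] [Module ℝ V]
    (Λ : AddSubgroup V) {S₀ : Set (V →ₗ[ℝ] ℝ)} (hS₀ : S₀.Finite)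
    (hint : ∀ f ∈ S₀, ∀ x ∈ Λ, ∃ n : ℤ, f x = n) (hzero : ∀ y, (∀ f ∈ S₀, 0 ≤ f y) → y = 0)
    {G : Set V} (hG : G.Finite) (hGΛ : G ⊆ Λ) :
    ∃ S : Set (V →ₗ[ℝ] ℝ), S.Finite ∧ (∀ f ∈ S, ∀ x ∈ Λ, ∃ n : ℤ, f x = n) ∧
      ∀ y, y ∈ PointedCone.hull ℝ G ↔ ∀ f ∈ S, 0 ≤ f y := by
  induction G, hG using Set.Finite.induction_on with
  | empty =>
    refine ⟨S₀, hS₀, hint, fun y => ⟨?_, fun h => ?_⟩⟩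
    · intro h
      have : y = 0 := by simpa [PointedCone.hull] using h
      simp [this]
    · rw [hzero y h]; exact zero_mem _
  | @insert g G _ hG ih =>
    obtain ⟨S, hS, hSint, hSG⟩ := ih fun x hx => hGΛ (Set.mem_insert_of_mem _ hx)
    have hg : g ∈ Λ := hGΛ (Set.mem_insert _ _)
    -- Eliminate `s ≥ 0` from `f y - s * f g ≥ 0`: keep the functionals nonnegative at `g`, and for
    -- each pair of opposite signs take the positive combination vanishing at `g`. Its coefficients
    -- are integers since `g ∈ Λ`.
    refine ⟨{f ∈ S | 0 ≤ f g} ∪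
      (fun q : (V →ₗ[ℝ] ℝ) × (V →ₗ[ℝ] ℝ) => q.1 g • q.2 - q.2 g • q.1) ''
        {q ∈ S ×ˢ S | 0 < q.1 g ∧ q.2 g < 0},
      (hS.subset (Set.sep_subset _ _)).union (((hS.prod hS).subset (Set.sep_subset _ _)).image _),
      ?_, fun y => ?_⟩
    · rintro f (hf | ⟨⟨p, q⟩, ⟨⟨hp, hq⟩, -⟩, rfl⟩) x hx
      · exact hSint f hf.1 x hx
      · obtain ⟨a, ha⟩ := hSint p hp g hg
        obtain ⟨b, hb⟩ := hSint q hq g hg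
        obtain ⟨a', ha'⟩ := hSint p hp x hx
        obtain ⟨b', hb'⟩ := hSint q hq x hx
        refine ⟨a * b' - b * a', ?_⟩
        simp [ha, hb, ha', hb']
    · have hmem : y ∈ PointedCone.hull ℝ (insert g G) ↔
          ∃ s : ℝ, 0 ≤ s ∧ ∀ f ∈ S, 0 ≤ f y - s * f g := by
        rw [PointedCone.hull, Submodule.mem_span_insert]
        constructor
        · rintro ⟨a, z, hz, rfl⟩
          refine ⟨a, a.2, fun f hf => ?_⟩
          have := (hSG z).1 hz f hf
          have h2 : f (a • g) = (a : ℝ) * f g := by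
            rw [← Nonneg.coe_smul, map_smul, smul_eq_mul]
          rw [map_add, h2]
          linarith
        · rintro ⟨s, hs, h⟩
          refine ⟨⟨s, hs⟩, y - s • g, (hSG _).2 fun f hf => ?_, ?_⟩
          · simpa using h f hf
          · rw [Nonneg.mk_smul]; abel
      rw [hmem]
      constructor
      · rintro ⟨s, hs, h⟩ f (hf | ⟨⟨p, q⟩, ⟨⟨hp, hq⟩, hp0, hq0⟩, rfl⟩)
        · have := h f hf.1
          have := mul_nonneg hs hf.2
          linarith
        · have h1 := h p hp
          have h2 := h q hq
          simp only [LinearMap.sub_apply, LinearMap.smul_apply, smul_eq_mul] at *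
          nlinarith [mul_nonneg hp0.le h2, mul_nonneg (neg_nonneg.2 hq0.le) h1]
      · intro h
        -- These are the lower bounds on `s`; the largest of them is a solution.
        set B : Set ℝ := (fun f : V →ₗ[ℝ] ℝ => f y / f g) '' {f ∈ S | f g < 0} ∪ {0} with hB
        have hBfin : B.Finite :=
          ((hS.subset (Set.sep_subset _ _)).image _).union (Set.finite_singleton 0)
        obtain ⟨s, hsB, hsmax⟩ := hBfin.exists_maximal ⟨0, Or.inr rfl⟩
        have hmax : ∀ b ∈ B, b ≤ s := fun b hb => by
          by_contra hlt
          exact hlt (hsmax hb (not_le.1 hlt).le)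
        refine ⟨s, hmax 0 (Or.inr rfl), fun f hf => ?_⟩
        rcases lt_trichotomy (f g) 0 with hneg | h0 | hpos
        · have := hmax _ (Or.inl ⟨f, ⟨hf, hneg⟩, rfl⟩)
          simp only at this
          rw [div_le_iff_of_neg hneg] at this
          linarith
        · have := h f (Or.inl ⟨hf, h0.ge⟩)
          rw [h0]; simpa using this
        · rcases hsB with ⟨q, ⟨hq, hq0⟩, rfl⟩ | rfl
          · have := h _ (Or.inr ⟨(f, q), ⟨⟨hf, hq⟩, hpos, hq0⟩, rfl⟩)
            simp only [LinearMap.sub_apply, LinearMap.smul_apply, smul_eq_mul] at this ⊢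
            have h3 : f y - q y / q g * f g = (f g * q y - q g * f y) / (- q g) := by
              field_simp [hq0.ne]; ring
            rw [h3]
            exact div_nonneg this (by linarith)
          · have := h f (Or.inl ⟨hf, hpos.le⟩)
            simpa using this

/-- The cone over `A × {1}` consists of the pairs `(y, t)` with `y ∈ t • convexHull A`. -/
theorem mem_hull_prod_one_iff {V : Type*} [AddCommGroup V] [Module ℝ V] {A : Set V}
    (hA : A.Nonempty) (y : V) {t : ℝ} (ht : 0 ≤ t) :
    (y, t) ∈ PointedCone.hull ℝ ((fun a => (a, (1 : ℝ))) '' A) ↔ y ∈ t • convexHull ℝ A := by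
  constructor
  · have hspan : ∀ z ∈ PointedCone.hull ℝ ((fun a => (a, (1 : ℝ))) '' A),
        0 ≤ z.2 ∧ z.1 ∈ z.2 • convexHull ℝ A := by
      intro z hz
      refine Submodule.span_induction ?_ ?_ ?_ ?_ hz
      · rintro _ ⟨a, ha, rfl⟩
        simpa using subset_convexHull ℝ A ha
      · simp [Set.zero_smul_set (hA.convexHull (𝕜 := ℝ))]
      · rintro x x' - - ⟨h1, h2⟩ ⟨h3, h4⟩
        refine ⟨add_nonneg h1 h3, ?_⟩
        rw [Prod.snd_add, (convex_convexHull ℝ A).add_smul h1 h3]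
        exact Set.add_mem_add h2 h4
      · rintro a x - ⟨h1, h2⟩
        refine ⟨mul_nonneg a.2 h1, ?_⟩
        obtain ⟨w, hw, hw2⟩ := h2
        refine ⟨w, hw, ?_⟩
        have : (a • x).2 = (a : ℝ) * x.2 := rfl
        simp only at hw2 ⊢
        rw [this, mul_smul, hw2]
        rfl
    exact fun h => (hspan _ h).2
  · rintro ⟨w, hw, rfl⟩
    have h1 : (w, (1 : ℝ)) ∈ PointedCone.hull ℝ ((fun a => (a, (1 : ℝ))) '' A) := by
      have hconv : Convex ℝ {w : V | (w, (1 : ℝ)) ∈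
          PointedCone.hull ℝ ((fun a => (a, (1 : ℝ))) '' A)} := by
        intro x hx x' hx' a b ha hb hab
        have := add_mem
          (Submodule.smul_mem (PointedCone.hull ℝ ((fun a => (a, (1 : ℝ))) '' A))
            (⟨a, ha⟩ : {c : ℝ // 0 ≤ c}) hx)
          (Submodule.smul_mem (PointedCone.hull ℝ ((fun a => (a, (1 : ℝ))) '' A))
            (⟨b, hb⟩ : {c : ℝ // 0 ≤ c}) hx')
        simpa [hab] using this
      exact convexHull_min (fun a ha => show (a, (1 : ℝ)) ∈
        PointedCone.hull ℝ ((fun a => (a, (1 : ℝ))) '' A) from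
        Submodule.subset_span ⟨a, ha, rfl⟩) hconv hw
    have := Submodule.smul_mem (PointedCone.hull ℝ ((fun a => (a, (1 : ℝ))) '' A))
      (⟨t, ht⟩ : {c : ℝ // 0 ≤ c}) h1
    simpa using this

/-- A lattice polytope and its dilates are cut out by finitely many inequalities with integer
coefficients, as far as lattice points are concerned. -/
theorem IsLatticePolytope.exists_inequalities {d : ℕ} {P : Set (Fin d → ℝ)}
    (hP : IsLatticePolytope P) :
    ∃ (ι : Type) (_ : Fintype ι) (u : ι → (Fin d → ℤ) →+ ℤ) (h : ι → ℤ) (C : ℕ),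
      (∀ (t : ℕ) (y : Fin d → ℤ),
        latticeHom d y ∈ (t : ℝ) • P ↔ ∀ j, 0 ≤ u j y + t * h j) ∧
      (∀ (t : ℕ) (y : Fin d → ℤ), (∀ j, 0 ≤ u j y + t * h j) → ∀ j, u j y + t * h j ≤ C * t) ∧
      (∀ v, v ≠ 0 → ∃ j, u j v < 0) ∧ ∃ a, ∀ j, 0 ≤ u j a + h j := by
  obtain ⟨W, hW, rfl⟩ := hP
  change ∃ (ι : Type) (_ : Fintype ι) (u : ι → (Fin d → ℤ) →+ ℤ) (h : ι → ℤ) (C : ℕ),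
      (∀ (t : ℕ) (y : Fin d → ℤ), latticeHom d y ∈
        (t : ℝ) • convexHull ℝ (latticeHom d '' (W : Set (Fin d → ℤ))) ↔ _) ∧ _
  set A : Set (Fin d → ℝ) := latticeHom d '' (W : Set (Fin d → ℤ)) with hA
  have hAne : A.Nonempty := ⟨_, hW.choose, hW.choose_spec, rfl⟩
  have hAfin : A.Finite := W.finite_toSet.image _
  set Φ : (Fin d → ℤ) × ℤ →+ (Fin d → ℝ) × ℝ :=
    (latticeHom d).prodMap (Int.castAddHom ℝ) with hΦ
  set e : Fin d → (Fin d → ℝ) × ℝ →ₗ[ℝ] ℝ := fun i => (LinearMap.proj i).comp (LinearMap.fst ℝ (Fin d → ℝ) ℝ)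
  set e' : (Fin d → ℝ) × ℝ →ₗ[ℝ] ℝ := LinearMap.snd ℝ (Fin d → ℝ) ℝ
  -- Homogenise: all dilates are slices of the cone over `A × {1}`. The coordinates and their
  -- negatives cut out the zero cone.
  obtain ⟨S, hS, hSint, hSmem⟩ := exists_finite_functionals_span Φ.range
    (S₀ := Set.range e ∪ Set.range (fun i => -e i) ∪ {e', -e'})
    (((Set.finite_range _).union (Set.finite_range _)).union (by simp))
    (by
      rintro f ((⟨i, rfl⟩ | ⟨i, rfl⟩) | rfl | rfl) _ ⟨⟨v, n⟩, rfl⟩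
      · exact ⟨v i, rfl⟩
      · exact ⟨-v i, by simp [e, hΦ, latticeHom_apply]⟩
      · exact ⟨n, rfl⟩
      · exact ⟨-n, by simp [e', hΦ]⟩)
    (by
      intro y hy
      ext i
      · have h1 := hy (e i) (Or.inl (Or.inl ⟨i, rfl⟩))
        have h2 := hy (-e i) (Or.inl (Or.inr ⟨i, rfl⟩))
        simp only [e, LinearMap.neg_apply, LinearMap.comp_apply, LinearMap.proj_apply,
          LinearMap.fst_apply] at h1 h2
        exact le_antisymm (neg_nonneg.1 h2) h1
      · have h1 := hy e' (Or.inr (Or.inl rfl))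
        have h2 := hy (-e') (Or.inr (Or.inr rfl))
        simp only [e', LinearMap.neg_apply, LinearMap.snd_apply] at h1 h2
        exact le_antisymm (neg_nonneg.1 h2) h1)
    (hAfin.image fun a => (a, (1 : ℝ)))
    (by
      rintro _ ⟨_, ⟨v, -, rfl⟩, rfl⟩
      exact ⟨(v, 1), by simp [hΦ]⟩)
  have hex : ∀ (f : S) (x : (Fin d → ℤ) × ℤ), ∃ n : ℤ, f.1 (Φ x) = n := fun f x =>
    hSint f.1 f.2 _ ⟨x, rfl⟩
  choose φ hφ using hex
  have hφadd : ∀ f x y, φ f (x + y) = φ f x + φ f y := fun f x y => by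
    have : (φ f (x + y) : ℝ) = φ f x + φ f y := by
      rw [← hφ, ← hφ, ← hφ, map_add, map_add]
    exact_mod_cast this
  set ψ : S → ((Fin d → ℤ) × ℤ) →+ ℤ := fun f => AddMonoidHom.mk' (φ f) (hφadd f) with hψ
  have hval : ∀ (f : S) (y : Fin d → ℤ) (t : ℕ),
      ((((ψ f).comp (AddMonoidHom.inl _ _)) y + t * ψ f (0, 1) : ℤ) : ℝ) =
        f.1 (latticeHom d y, (t : ℝ)) := by
    intro f y t
    have h1 : ((ψ f).comp (AddMonoidHom.inl _ _)) y + t * ψ f (0, 1) = ψ f (y, (t : ℤ)) := by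
      have h2 : (y, (t : ℤ)) = (y, 0) + t • ((0, 1) : (Fin d → ℤ) × ℤ) := by simp
      rw [h2, map_add, map_nsmul]
      simp
    rw [h1]
    simp only [hψ, AddMonoidHom.mk'_apply]
    rw [← hφ]
    rfl
  have hmem : ∀ (t : ℕ) (y : Fin d → ℤ), latticeHom d y ∈ (t : ℝ) • convexHull ℝ A ↔
      ∀ f : S, 0 ≤ ((ψ f).comp (AddMonoidHom.inl _ _)) y + t * ψ f (0, 1) := by
    intro t y
    rw [← mem_hull_prod_one_iff hAne _ t.cast_nonneg, hSmem]
    constructor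
    · intro h f
      have := h f.1 f.2
      rw [← hval f y t] at this
      exact_mod_cast this
    · intro h f hf
      rw [← hval ⟨f, hf⟩ y t]
      exact_mod_cast h ⟨f, hf⟩
  obtain ⟨M, hM⟩ : ∃ M : ℝ, ∀ f ∈ S, ∀ a ∈ A, f (a, 1) ≤ M := by
    obtain ⟨M, hM⟩ := ((hS.prod hAfin).image
      fun q : ((Fin d → ℝ) × ℝ →ₗ[ℝ] ℝ) × (Fin d → ℝ) => q.1 (q.2, 1)).bddAbove
    exact ⟨M, fun f hf a ha => hM ⟨(f, a), ⟨hf, ha⟩, rfl⟩⟩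
  refine ⟨S, hS.fintype, fun f => (ψ f).comp (AddMonoidHom.inl _ _), fun f => ψ f (0, 1),
    ⌈M⌉₊, hmem, ?_, ?_, ?_⟩
  · intro t y hy f
    obtain ⟨w, hw, hwy⟩ := (hmem t y).2 hy
    have hwM : f.1 (w, 1) ≤ M := by
      have hconv : Convex ℝ {w : Fin d → ℝ | f.1 (w, 1) ≤ M} := by
        intro x hx x' hx' a b ha hb hab
        have h1 : ((a • x + b • x', 1) : (Fin d → ℝ) × ℝ) = a • ((x, 1) : (Fin d → ℝ) × ℝ) + b • ((x', 1) : (Fin d → ℝ) × ℝ) := by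
          simp [hab]
        rw [Set.mem_ofPred_eq, h1, map_add, map_smul, map_smul, smul_eq_mul, smul_eq_mul]
        have h2 := mul_le_mul_of_nonneg_left (show f.1 (x, 1) ≤ M from hx) ha
        have h3 := mul_le_mul_of_nonneg_left (show f.1 (x', 1) ≤ M from hx') hb
        calc _ ≤ a * M + b * M := add_le_add h2 h3
          _ = M := by rw [← add_mul, hab, one_mul]
      exact convexHull_min (fun a ha => hM f.1 f.2 a ha) hconv hw
    have h1 : (latticeHom d y, (t : ℝ)) = (t : ℝ) • ((w, 1) : (Fin d → ℝ) × ℝ) := by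
      rw [← hwy]; simp
    have h2 : ((((ψ f).comp (AddMonoidHom.inl _ _)) y + t * ψ f (0, 1) : ℤ) : ℝ) ≤
        ((⌈M⌉₊ * t : ℤ) : ℝ) := by
      rw [hval, h1, map_smul, smul_eq_mul, mul_comm]
      push_cast
      exact mul_le_mul_of_nonneg_right (hwM.trans (Nat.le_ceil M)) t.cast_nonneg
    exact_mod_cast h2
  · intro v hv
    by_contra! hcon
    apply hv
    -- The slice at `t = 0` is `{0}`, which expresses boundedness.
    have h1 := (hmem 0 v).2 fun f => by simpa using hcon f
    rw [Nat.cast_zero, Set.zero_smul_set (hAne.convexHull (𝕜 := ℝ))] at h1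
    exact latticeHom_injective d (by simpa using h1)
  · obtain ⟨a, ha⟩ := hW
    refine ⟨a, fun f => ?_⟩
    have := (hmem 1 a).1 (by simpa using subset_convexHull ℝ A ⟨a, ha, rfl⟩) f
    simpa using this

/-- A consequence of **Dickson's lemma**: a map to a well-quasi-ordered set has finitely many values
that lie below all others. -/
theorem exists_finite_forall_exists_le {α β : Type*} [PartialOrder β] [WellQuasiOrderedLE β]
    (f : α → β) : ∃ S : Set α, S.Finite ∧ ∀ a, ∃ b ∈ S, f b ≤ f a := by
  have hfin : {y | Minimal (· ∈ Set.range f) y}.Finite :=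
    WellQuasiOrderedLE.finite_of_isAntichain (setOfPred_minimal_antichain _)
  have hex : ∀ y : {y | Minimal (· ∈ Set.range f) y}, ∃ a, f a = y := fun y => y.2.1
  choose g hg using hex
  have := hfin.to_subtype
  refine ⟨Set.range g, Set.finite_range g, fun a => ?_⟩
  obtain ⟨m, hm, hmin⟩ := exists_minimal_le_of_wellFoundedLT (· ∈ Set.range f) (f a) ⟨a, rfl⟩
  exact ⟨g ⟨m, hmin⟩, ⟨_, rfl⟩, by rw [hg]; exact hm⟩

/-! ### Zonotopes in dilates and the reduction to finitely many sets of vectors -/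

section Fits

variable {d : ℕ} {ι : Type*}

/-- How far the segment `[0, v]` reaches below the origin in the direction `u j`. -/
def depth (u : ι → (Fin d → ℤ) →+ ℤ) (j : ι) (v : Fin d → ℤ) : ℕ := (-(u j v)).toNat

/-- A lattice translate of the zonotope `∑ v ∈ s, [0, v]` satisfies the inequalities
`0 ≤ u j y + t * h j`. -/
def Fits (u : ι → (Fin d → ℤ) →+ ℤ) (h : ι → ℤ) (t : ℕ) (s : Multiset (Fin d → ℤ)) : Prop :=
  ∃ a, ∀ j, ((s.map (depth u j)).sum : ℤ) ≤ u j a + t * h j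

/-- All elements of `A` lie in a real subspace of dimension at most `n`. -/
def SpanLE (n : ℕ) (A : Set (Fin d → ℤ)) : Prop :=
  ∃ W : Submodule ℝ (Fin d → ℝ), Module.finrank ℝ W ≤ n ∧ ∀ v ∈ A, latticeHom d v ∈ W

variable {u : ι → (Fin d → ℤ) →+ ℤ} {h : ι → ℤ}

theorem Fits.mono {t : ℕ} {s s' : Multiset (Fin d → ℤ)} (hs : Fits u h t s)
    (hle : ∀ j, (s'.map (depth u j)).sum ≤ (s.map (depth u j)).sum) : Fits u h t s' := by
  obtain ⟨a, ha⟩ := hs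
  exact ⟨a, fun j => le_trans (by exact_mod_cast hle j) (ha j)⟩

theorem Fits.add {t t' : ℕ} {s s' : Multiset (Fin d → ℤ)} (hs : Fits u h t s)
    (hs' : Fits u h t' s') : Fits u h (t + t') (s + s') := by
  obtain ⟨a, ha⟩ := hs
  obtain ⟨a', ha'⟩ := hs'
  refine ⟨a + a', fun j => ?_⟩
  have := ha j
  have := ha' j
  rw [Multiset.map_add, Multiset.sum_add, map_add]
  push_cast at *
  linarith

theorem fits_zero (ha : ∃ a, ∀ j, 0 ≤ u j a + h j) (t : ℕ) : Fits u h t 0 := by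
  obtain ⟨a, ha⟩ := ha
  refine ⟨t • a, fun j => ?_⟩
  rw [map_nsmul, nsmul_eq_mul, ← mul_add]
  simpa using mul_nonneg (Int.natCast_nonneg t) (ha j)

/-- Each nonzero vector adds at least 1 to the depth in some direction, and the total depth in each
direction is at most `C * t`. -/
theorem Fits.card_le [Fintype ι] {C : ℕ}
    (hC : ∀ (t : ℕ) (y : Fin d → ℤ), (∀ j, 0 ≤ u j y + t * h j) → ∀ j, u j y + t * h j ≤ C * t)
    (hneg : ∀ v, v ≠ 0 → ∃ j, u j v < 0) {t : ℕ} {s : Multiset (Fin d → ℤ)} (h0 : 0 ∉ s)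
    (hs : Fits u h t s) : s.card ≤ Fintype.card ι * C * t := by
  obtain ⟨a, ha⟩ := hs
  have h1 : s.card ≤ (s.map fun v => ∑ j, depth u j v).sum := by
    have := Multiset.card_nsmul_le_sum (s := s.map fun v => ∑ j, depth u j v) (a := 1) (by
      intro x hx
      obtain ⟨v, hv, rfl⟩ := Multiset.mem_map.1 hx
      obtain ⟨j, hj⟩ := hneg v (fun h => h0 (h ▸ hv))
      have h2 : 1 ≤ depth u j v := by simp only [depth]; omega
      exact h2.trans (Finset.single_le_sum (f := fun j => depth u j v)
        (fun _ _ => Nat.zero_le _) (Finset.mem_univ j)))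
    simpa using this
  have h2 : (s.map fun v => ∑ j, depth u j v).sum = ∑ j, (s.map (depth u j)).sum :=
    Multiset.sum_map_sum_map (m := s) (n := Finset.univ.val) (f := fun v j => depth u j v)
  have h3 : ∀ j, (s.map (depth u j)).sum ≤ C * t := fun j => by
    have := (ha j).trans (hC t a (fun j => (Int.natCast_nonneg _).trans (ha j)) j)
    exact_mod_cast this
  calc s.card ≤ ∑ j, (s.map (depth u j)).sum := h2 ▸ h1
    _ ≤ ∑ _j : ι, C * t := Finset.sum_le_sum fun j _ => h3 j
    _ = Fintype.card ι * C * t := by simp [mul_assoc]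

/-- The squared length of an integer vector. -/
def sqLength (v : Fin d → ℤ) : ℕ := ∑ i, (v i).natAbs ^ 2

theorem sqLength_pos {v : Fin d → ℤ} (hv : v ≠ 0) : 0 < sqLength v := by
  obtain ⟨i, hi⟩ := Function.ne_iff.1 hv
  refine lt_of_lt_of_le ?_ (Finset.single_le_sum (f := fun i => (v i).natAbs ^ 2)
    (fun _ _ => Nat.zero_le _) (Finset.mem_univ i))
  exact pow_pos (Int.natAbs_pos.2 hi) 2

theorem sqLength_two_smul (v : Fin d → ℤ) : sqLength ((2 : ℤ) • v) = 4 * sqLength v := by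
  simp only [sqLength, Finset.mul_sum]
  refine Finset.sum_congr rfl fun i _ => ?_
  simp [Int.natAbs_mul, mul_pow]

theorem sqLength_midpoint (v z : Fin d → ℤ) :
    sqLength (v + (4 : ℤ) • z) + sqLength v = 2 * sqLength (v + (2 : ℤ) • z) + 8 * sqLength z := by
  simp only [sqLength, Finset.mul_sum, ← Finset.sum_add_distrib]
  refine Finset.sum_congr rfl fun i _ => ?_
  zify
  simp only [sq_abs, Pi.add_apply, Pi.smul_apply, smul_eq_mul]
  ring

/-- The residues modulo 4 of the coordinates. -/
def residue (v : Fin d → ℤ) : Fin d → ZMod 4 := fun i => (v i : ZMod 4)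

theorem exists_eq_add_of_residue_eq {v w : Fin d → ℤ} (hvw : residue v = residue w) :
    ∃ z, v = w + (4 : ℤ) • z := by
  have hi : ∀ i, ∃ z, v i = w i + 4 * z := fun i => by
    have := (ZMod.intCast_eq_intCast_iff_dvd_sub _ _ _).1 (congrFun hvw i).symm
    obtain ⟨z, hz⟩ := this
    exact ⟨z, by push_cast at hz; linarith⟩
  choose z hz using hi
  exact ⟨z, funext fun i => by simpa using hz i⟩

/-- The segments of a zonotope may be shortened until distinct segments are incongruent
modulo 4. -/
theorem Fits.exists_residue_injOn {W : Submodule ℝ (Fin d → ℝ)} {t : ℕ}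
    {s : Multiset (Fin d → ℤ)} (hs : Fits u h t s) (h0 : 0 ∉ s) (hW : ∀ v ∈ s, latticeHom d v ∈ W) :
    ∃ s' : Multiset (Fin d → ℤ), s'.card = s.card ∧ Fits u h t s' ∧ 0 ∉ s' ∧
      (∀ v ∈ s', latticeHom d v ∈ W) ∧ ∀ v ∈ s', ∀ w ∈ s', residue v = residue w → v = w := by
  -- Every replacement below lowers the total squared length.
  induction hn : (s.map sqLength).sum using Nat.strong_induction_on generalizing s with
  | _ n ih =>
    have hhalf : ∀ y, (2 : ℤ) • y ∈ s → ∃ s' : Multiset (Fin d → ℤ), s'.card = s.card ∧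
        Fits u h t s' ∧ 0 ∉ s' ∧ (∀ v ∈ s', latticeHom d v ∈ W) ∧
        ∀ v ∈ s', ∀ w ∈ s', residue v = residue w → v = w := by
      intro y hy
      obtain ⟨r, rfl⟩ := Multiset.exists_cons_of_mem hy
      have hy0 : y ≠ 0 := by rintro rfl; simp at h0
      have hyW : latticeHom d y ∈ W := by
        have h1 := W.smul_mem (1 / 2 : ℝ) (hW _ hy)
        rwa [map_zsmul, ← Int.cast_smul_eq_zsmul ℝ, smul_smul, Int.cast_ofNat,
          one_div, inv_mul_cancel₀ two_ne_zero, one_smul] at h1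
      have hlt : ((y ::ₘ r).map sqLength).sum < n := by
        rw [← hn, Multiset.map_cons, Multiset.map_cons, Multiset.sum_cons, Multiset.sum_cons,
          sqLength_two_smul]
        have := sqLength_pos hy0
        omega
      obtain ⟨s', hcard, hrest⟩ := ih _ hlt (s := y ::ₘ r)
        (hs.mono fun j => by
          simp only [Multiset.map_cons, Multiset.sum_cons, depth, map_zsmul, smul_eq_mul]
          omega)
        (by simp only [Multiset.mem_cons, not_or] at h0 ⊢; exact ⟨hy0.symm, h0.2⟩)
        (by
          intro v hv
          rcases Multiset.mem_cons.1 hv with rfl | hv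
          · exact hyW
          · exact hW v (Multiset.mem_cons_of_mem hv)) rfl
      exact ⟨s', by simpa using hcard, hrest⟩
    by_cases hinj : ∀ v ∈ s, ∀ w ∈ s, residue v = residue w → v = w
    · exact ⟨s, rfl, hs, h0, hW, hinj⟩
    push Not at hinj
    obtain ⟨v, hv, w, hw, hvw, hne⟩ := hinj
    obtain ⟨z, rfl⟩ := exists_eq_add_of_residue_eq hvw
    have hz : z ≠ 0 := by rintro rfl; simp at hne
    -- A zero midpoint is not allowed as a segment. Here it forces `v = 2z`, which can be halved;
    -- modulo 2 an opposite pair `v`, `-v` would leave no such way out.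
    by_cases hm : w + (2 : ℤ) • z = 0
    · refine hhalf z ?_
      have : w + (4 : ℤ) • z = (2 : ℤ) • z := by
        calc w + (4 : ℤ) • z = (w + (2 : ℤ) • z) + (2 : ℤ) • z := by
              rw [add_assoc, ← add_smul]; norm_num
          _ = (2 : ℤ) • z := by rw [hm, zero_add]
      rwa [this] at hv
    obtain ⟨r, rfl⟩ := Multiset.exists_cons_of_mem hv
    have hwr : w ∈ r := (Multiset.mem_cons.1 hw).resolve_left hne.symm
    obtain ⟨r, rfl⟩ := Multiset.exists_cons_of_mem hwr
    -- Replace both vectors by their midpoint: depth is convex, and the parallelogram identity gives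
    -- the decrease in length.
    set m := w + (2 : ℤ) • z with hmdef
    have hmW : latticeHom d m ∈ W := by
      have h1 := W.smul_mem (1 / 2 : ℝ) (W.add_mem (hW _ hv) (hW _ hw))
      convert h1 using 1
      ext i
      simp [hmdef, latticeHom_apply]
      ring
    have hlt : ((m ::ₘ m ::ₘ r).map sqLength).sum < n := by
      rw [← hn]
      simp only [Multiset.map_cons, Multiset.sum_cons]
      have := sqLength_midpoint w z
      have := sqLength_pos hz
      rw [← hmdef] at *
      omega
    obtain ⟨s', hcard, hrest⟩ := ih _ hlt (s := m ::ₘ m ::ₘ r)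
      (hs.mono fun j => by
        simp only [Multiset.map_cons, Multiset.sum_cons, depth, map_zsmul, smul_eq_mul, hmdef,
          map_add]
        omega)
      (by simp only [Multiset.mem_cons, not_or] at h0 ⊢
          exact ⟨Ne.symm hm, Ne.symm hm, h0.2.2⟩)
      (by
        intro v hv
        rcases Multiset.mem_cons.1 hv with rfl | hv
        · exact hmW
        rcases Multiset.mem_cons.1 hv with rfl | hv
        · exact hmW
        exact hW v (Multiset.mem_cons_of_mem (Multiset.mem_cons_of_mem hv))) rfl
    exact ⟨s', by simpa using hcard, hrest⟩

/-- Finitely many finite sets of lattice vectors of bounded rank suffice to realise every number of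
segments, in all dilates simultaneously. -/
theorem exists_finite_families [Finite ι] (u : ι → (Fin d → ℤ) →+ ℤ) (h : ι → ℤ) (n : ℕ) :
    ∃ 𝒱 : Set (Finset (Fin d → ℤ)), 𝒱.Finite ∧ (∀ V ∈ 𝒱, 0 ∉ V ∧ SpanLE n (V : Set (Fin d → ℤ))) ∧
      ∀ t s, 0 ∉ s → Fits u h t s → SpanLE n {v | v ∈ s} →
        ∃ V ∈ 𝒱, ∃ s' : Multiset (Fin d → ℤ), s'.card = s.card ∧ (∀ v ∈ s', v ∈ V) ∧
          Fits u h t s' := by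
  classical
  -- Dickson's lemma on choices of one vector per residue class, compared by depths. The 0/1 entry
  -- prevents a nonzero vector from being replaced by zero, and the subtype keeps the rank bound.
  obtain ⟨S, hS, hSle⟩ := exists_finite_forall_exists_le
    (fun (x : {x : (Fin d → ZMod 4) → Fin d → ℤ // SpanLE n (Set.range x)}) c =>
      ((if x.1 c = 0 then 1 else 0 : ℕ), fun j => depth u j (x.1 c)))
  refine ⟨(fun x => (Finset.univ.image x.1).erase 0) '' S, hS.image _, ?_, ?_⟩
  · rintro _ ⟨⟨x, W, hW, hx⟩, -, rfl⟩
    refine ⟨Finset.notMem_erase _ _, W, hW, fun v hv => hx v ?_⟩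
    simpa using Finset.mem_of_mem_erase (Finset.mem_coe.1 hv)
  · rintro t s h0 hs ⟨W, hW, hsW⟩
    obtain ⟨s₁, hcard, hs₁, h0₁, hW₁, hinj⟩ := hs.exists_residue_injOn h0 hsW
    set x : (Fin d → ZMod 4) → Fin d → ℤ := fun c =>
      if hc : ∃ v ∈ s₁, residue v = c then hc.choose else 0 with hxdef
    have hx : ∀ v ∈ s₁, x (residue v) = v := fun v hv => by
      have hc : ∃ w ∈ s₁, residue w = residue v := ⟨v, hv, rfl⟩
      simp only [hxdef, dif_pos hc]
      exact hinj _ hc.choose_spec.1 _ hv hc.choose_spec.2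
    have hxW : SpanLE n (Set.range x) := by
      refine ⟨W, hW, ?_⟩
      rintro _ ⟨c, rfl⟩
      by_cases hc : ∃ v ∈ s₁, residue v = c
      · simp only [hxdef, dif_pos hc]
        exact hW₁ _ hc.choose_spec.1
      · simp only [hxdef, dif_neg hc, map_zero, W.zero_mem]
    obtain ⟨y, hyS, hyx⟩ := hSle ⟨x, hxW⟩
    have hy0 : ∀ v ∈ s₁, y.1 (residue v) ≠ 0 := fun v hv hy => by
      have h1 := (hyx (residue v)).1
      have h2 : v ≠ 0 := fun h => h0₁ (h ▸ hv)
      simp [hy, hx v hv, h2] at h1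
    refine ⟨_, ⟨y, hyS, rfl⟩, s₁.map (fun v => y.1 (residue v)), by simpa using hcard, ?_, ?_⟩
    · intro w hw
      obtain ⟨v, hv, rfl⟩ := Multiset.mem_map.1 hw
      exact Finset.mem_erase.2 ⟨hy0 v hv, Finset.mem_image_of_mem _ (Finset.mem_univ _)⟩
    · refine hs₁.mono fun j => ?_
      rw [Multiset.map_map]
      refine Multiset.sum_map_le_sum_map _ _ fun v hv => ?_
      have := (hyx (residue v)).2 j
      simpa [hx v hv] using this

/-! ### Attained slopes and eventual quasi-linearity -/

/-- For zonotopes with segments from a fixed finite set of vectors, the largest number of segments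
per dilation factor is attained. -/
theorem exists_maximal_ratio [Fintype ι] {C : ℕ}
    (hC : ∀ (t : ℕ) (y : Fin d → ℤ), (∀ j, 0 ≤ u j y + t * h j) → ∀ j, u j y + t * h j ≤ C * t)
    (hneg : ∀ v, v ≠ 0 → ∃ j, u j v < 0) (hne : ∃ a, ∀ j, 0 ≤ u j a + h j)
    {V : Finset (Fin d → ℤ)} (h0 : 0 ∉ V) :
    ∃ (k : ℕ) (s₀ : Multiset (Fin d → ℤ)), 1 ≤ k ∧ (∀ v ∈ s₀, v ∈ V) ∧ Fits u h k s₀ ∧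
      ∀ t s, (∀ v ∈ s, v ∈ V) → Fits u h t s → s.card * k ≤ s₀.card * t := by
  classical
  -- Recording `t`, multiplicities and slacks makes the difference of comparable solutions a
  -- solution again, so one from `S` can be split off. Since its `t'` is at least 1, the induction
  -- on `t` descends.
  obtain ⟨S, hS, hSle⟩ := exists_finite_forall_exists_le
    (fun (p : {p : ℕ × (Fin d → ℤ) × Multiset (Fin d → ℤ) // 1 ≤ p.1 ∧ (∀ v ∈ p.2.2, v ∈ V) ∧
        ∀ j, ((p.2.2.map (depth u j)).sum : ℤ) ≤ u j p.2.1 + p.1 * h j}) =>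
      (p.1.1, (fun v : V => p.1.2.2.count v.1),
        fun j => (u j p.1.2.1 + p.1.1 * h j - (p.1.2.2.map (depth u j)).sum).toNat))
  obtain ⟨a₀, ha₀⟩ := hne
  obtain ⟨p₀, hp₀, -⟩ := hSle ⟨(1, a₀, 0), le_rfl, by simp, by simpa using ha₀⟩
  obtain ⟨g, hg, hmax⟩ := Set.exists_max_image S
    (fun p => (p.1.2.2.card : ℚ) / p.1.1) hS ⟨p₀, hp₀⟩
  refine ⟨g.1.1, g.1.2.2, g.2.1, g.2.2.1, ⟨g.1.2.1, g.2.2.2⟩, ?_⟩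
  intro t
  induction t using Nat.strong_induction_on with
  | _ t ih =>
    intro s hsV hs
    rcases Nat.eq_zero_or_pos t with rfl | ht
    · have := hs.card_le hC hneg (fun h => h0 (hsV 0 h))
      simp at this
      simp [this]
    · obtain ⟨a, ha⟩ := hs
      obtain ⟨⟨⟨t', a', s'⟩, ht', hs'V, ha'⟩, hp', hle1, hle2, hle3⟩ :=
        hSle ⟨(t, a, s), ht, hsV, ha⟩
      have hratio := hmax _ hp'
      simp only at ht' hs'V ha' hle1 hle2 hle3 hratio
      have hs's : s' ≤ s := by
        rw [Multiset.le_iff_count]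
        intro v
        by_cases hv : v ∈ V
        · exact hle2 ⟨v, hv⟩
        · rw [Multiset.count_eq_zero_of_notMem fun hvs => hv (hs'V v hvs)]
          exact Nat.zero_le _
      obtain ⟨r, rfl⟩ := Multiset.le_iff_exists_add.1 hs's
      obtain ⟨q, rfl⟩ := Nat.exists_eq_add_of_le hle1
      have hr := ih q (by omega) r (fun v hv => hsV v (Multiset.mem_add.2 (Or.inr hv))) (by
        refine ⟨a - a', fun j => ?_⟩
        have h1 := hle3 j
        have h2 := ha j
        have h3 := ha' j
        simp only [Multiset.map_add, Multiset.sum_add] at h1 h2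
        rw [map_sub]
        push_cast at h1 h2 ⊢
        rw [add_mul] at h1 h2
        omega)
      have hg1 : (0 : ℚ) < g.1.1 := by exact_mod_cast g.2.1
      have ht1 : (0 : ℚ) < t' := by exact_mod_cast ht'
      rw [div_le_div_iff₀ ht1 hg1] at hratio
      have hratio' : s'.card * g.1.1 ≤ g.1.2.2.card * t' := by exact_mod_cast hratio
      rw [Multiset.card_add]
      nlinarith

end Fits

/-- A sequence that eventually gains at least `F k` in `k` steps, where `F k / k` is its largest
slope, is eventually quasi-linear. -/
theorem exists_eventually_eq_mul_div_add (F : ℕ → ℕ) {k : ℕ} (hk : 1 ≤ k)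
    (hslope : ∀ t, F t * k ≤ F k * t) (hmono : ∀ᶠ t in atTop, F t + F k ≤ F (t + k))
    (b : ℕ → ℕ) (hb : ∀ r j, b r + j * F k ≤ F (r + j * k)) :
    ∃ c : ℕ → ℕ, ∀ r < k, b r ≤ c r ∧ c r * k ≤ r * F k ∧
      ∀ᶠ t in atTop, t ≡ r [MOD k] → F t = F k * (t / k) + c r := by
  obtain ⟨T, hT⟩ := eventually_atTop.1 hmono
  have key : ∀ r, ∃ c, b r ≤ c ∧ c * k ≤ r * F k ∧
      ∀ᶠ j in atTop, F (r + j * k) = j * F k + c := by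
    intro r
    -- The excess over linear growth; by `hb` the subtraction is not truncated.
    set h : ℕ → ℕ := fun j => F (r + j * k) - j * F k with hh
    have hle : ∀ j, j * F k ≤ F (r + j * k) := fun j => le_trans (Nat.le_add_left _ _) (hb r j)
    have heq : ∀ j, F (r + j * k) = j * F k + h j := fun j => by
      have := hle j
      simp only [hh]; omega
    have hbd : ∀ j, h j * k ≤ r * F k := by
      intro j
      have h1 := hslope (r + j * k)
      rw [heq j] at h1
      nlinarith
    have hmono' : ∀ j, T ≤ j → h j ≤ h (j + 1) := by
      intro j hj
      have h1 := hT (r + j * k) (by nlinarith)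
      have h2 : r + j * k + k = r + (j + 1) * k := by ring
      rw [h2, heq, heq] at h1
      have : (j + 1) * F k = j * F k + F k := by ring
      omega
    have hmon : Monotone fun i => h (T + i) :=
      monotone_nat_of_le_succ fun i => hmono' (T + i) (by omega)
    have hbd' : ∀ j, h j ≤ r * F k := fun j =>
      le_trans (Nat.le_mul_of_pos_right _ hk) (hbd j)
    have hfin : (Set.range fun i => h (T + i)).Finite :=
      (Set.finite_Iic (r * F k)).subset (by rintro _ ⟨i, rfl⟩; exact hbd' _)
    obtain ⟨m, ⟨i, hi⟩, hm⟩ := hfin.exists_maximal ⟨_, 0, rfl⟩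
    have hconst : ∀ i', i ≤ i' → h (T + i') = m := by
      intro i' hi'
      have h1 : m ≤ h (T + i') := hi ▸ hmon hi'
      exact le_antisymm (hm ⟨i', rfl⟩ h1) h1
    refine ⟨m, ?_, ?_, ?_⟩
    · have h1 := hb r (T + i)
      rw [heq, hconst i le_rfl] at h1
      omega
    · rw [← hconst i le_rfl]; exact hbd _
    · filter_upwards [eventually_ge_atTop (T + i)] with j hj
      obtain ⟨l, rfl⟩ := Nat.exists_eq_add_of_le hj
      rw [heq, add_assoc T, hconst (i + l) (by omega)]
  choose c hc using key
  refine ⟨c, fun r hr => ⟨(hc r).1, (hc r).2.1, ?_⟩⟩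
  obtain ⟨J, hJ⟩ := eventually_atTop.1 (hc r).2.2
  filter_upwards [eventually_ge_atTop (J * k)] with t ht htr
  have h1 : t % k = r := by
    have := htr
    rw [Nat.ModEq, Nat.mod_eq_of_lt hr] at this
    exact this
  have h2 := hJ (t / k) ((Nat.le_div_iff_mul_le hk).2 ht)
  have h3 : r + t / k * k = t := by
    rw [← h1, mul_comm]; exact Nat.mod_add_div t k
  rw [h3] at h2
  rw [h2, mul_comm]

theorem superadditive_mul_le {f : ℕ → ℕ} (hf : ∀ s t, f s + f t ≤ f (s + t)) (j k : ℕ) :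
    j * f k ≤ f (j * k) := by
  induction j with
  | zero => simp
  | succ j ih =>
    have := hf (j * k) k
    rw [add_mul, one_mul, add_mul, one_mul]
    omega

/-- The maximum of finitely many superadditive sequences, each attaining its largest slope, has a
largest slope `F k / k`, and eventually gains at least `F k` in `k` steps. -/
theorem exists_slope_of_max_superadditive {κ : Type*} [Fintype κ] (f : κ → ℕ → ℕ)
    (hf : ∀ x s t, f x s + f x t ≤ f x (s + t))
    (hatt : ∀ x, ∃ k, 1 ≤ k ∧ ∀ t, f x t * k ≤ f x k * t)
    (F : ℕ → ℕ) (hle : ∀ x t, f x t ≤ F t) (hex : ∀ t, ∃ x, F t = f x t) :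
    ∃ k, 1 ≤ k ∧ (∀ t, F t * k ≤ F k * t) ∧ (∀ᶠ t in atTop, F t + F k ≤ F (t + k)) ∧
      ∀ r j, j * F k ≤ F (r + j * k) := by
  -- By superadditivity the slope of `f x` is also attained at every multiple of `p x`, so the
  -- product serves all `x`.
  choose p hp hslope using hatt
  set K := ∏ x, p x with hK
  have hK1 : 1 ≤ K := Finset.one_le_prod' fun x _ => hp x
  have hs : ∀ x t, f x t * K ≤ f x K * t := by
    intro x t
    obtain ⟨q, hq⟩ : p x ∣ K := Finset.dvd_prod_of_mem _ (Finset.mem_univ x)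
    have h1 := superadditive_mul_le (hf x) q (p x)
    rw [mul_comm q (p x), ← hq] at h1
    calc f x t * K = (f x t * p x) * q := by rw [hq]; ring
      _ ≤ (f x (p x) * t) * q := Nat.mul_le_mul_right _ (hslope x t)
      _ = (q * f x (p x)) * t := by ring
      _ ≤ f x K * t := Nat.mul_le_mul_right _ h1
  have hgrow : ∀ x, F K = f x K → ∀ r j, j * F K ≤ F (r + j * K) := by
    intro x hx r j
    have h1 := superadditive_mul_le (hf x) j K
    have h2 := hf x r (j * K)
    have h3 := hle x (r + j * K)
    rw [hx]
    omega
  obtain ⟨x₀, hx₀⟩ := hex K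
  refine ⟨K, hK1, ?_, ?_, hgrow x₀ hx₀⟩
  · intro t
    obtain ⟨x, hx⟩ := hex t
    rw [hx]
    exact (hs x t).trans (Nat.mul_le_mul_right _ (hle x K))
  -- If the maximiser `x` at `t` had `f x K < F K`, then with `q = t / K` one gets `q * F K ≤ f x K
  -- * (q + 1)`, hence `q ≤ f x K`, contradicting `q ≥ F K + 1`.
  · filter_upwards [eventually_ge_atTop ((F K + 1) * K)] with t ht
    obtain ⟨x, hx⟩ := hex t
    have hopt : f x K = F K := by
      by_contra hne
      have hlt : f x K + 1 ≤ F K := lt_of_le_of_ne (hle x K) hne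
      have h1 := hs x t
      rw [← hx] at h1
      have h2 := hgrow x₀ hx₀ (t % K) (t / K)
      rw [mul_comm (t / K) K, Nat.mod_add_div] at h2
      have h3 : t < (t / K + 1) * K := by
        have := Nat.lt_div_mul_add (a := t) hK1
        linarith
      have h4 : F K + 1 ≤ t / K := (Nat.le_div_iff_mul_le hK1).2 ht
      have h5 : t / K * F K * K ≤ f x K * t := (Nat.mul_le_mul_right _ h2).trans h1
      have h6 : f x K * t ≤ f x K * ((t / K + 1) * K) := Nat.mul_le_mul_left _ h3.le
      have h7 : t / K * F K * K ≤ (f x K * (t / K + 1)) * K := by linarith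
      have h8 : t / K * F K ≤ f x K * (t / K + 1) := Nat.le_of_mul_le_mul_right h7 hK1
      nlinarith
    rw [hx, ← hopt]
    exact (hf x t K).trans (hle x _)

/-- Eventual quasi-linearity with the given explicit form, for sequences of rationals. -/
theorem eventuallyQuasiLinear_of_eq {F : ℕ → ℕ} {k : ℕ} (hk : 1 ≤ k) {c : ℕ → ℕ}
    (hc : ∀ r < k, ∀ᶠ t in atTop, t ≡ r [MOD k] → F t = F k * (t / k) + c r) :
    EventuallyQuasiLinear (fun t => (F t : ℚ)) k := by
  set p : ℕ → Polynomial ℚ := fun r =>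
    Polynomial.C ((F k : ℚ) / k) * Polynomial.X + Polynomial.C ((c r : ℚ) - (F k : ℚ) / k * r)
    with hp
  have hpdeg : ∀ r, (p r).natDegree ≤ 1 := fun r => Polynomial.natDegree_linear_le
  have hk0 : (k : ℚ) ≠ 0 := by positivity
  set g : ℕ → ℚ := fun t => (p (t % k)).eval (t : ℚ) with hg
  have hgk : HasConstituents g k p := by
    refine ⟨hk, fun r hr t ht => ?_⟩
    have : t % k = r := by rw [Nat.ModEq, Nat.mod_eq_of_lt hr] at ht; exact ht
    simp only [hg, this]
  classical
  have hex : ∃ m, ∃ p, HasConstituents g m p := ⟨k, p, hgk⟩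
  obtain ⟨q, hq⟩ := Nat.find_spec hex
  refine ⟨g, Nat.find hex, ⟨⟨⟨q, hq⟩, fun m hm => Nat.find_min' hex hm⟩, q, hq, ?_⟩,
    Nat.find_min' hex ⟨p, hgk⟩, ?_⟩
  · intro r hr
    set k' := Nat.find hex
    -- The least period may be smaller than `k`, but its constituents agree with those of `p` on the
    -- infinite set `r + k' * k * ℕ`.
    suffices q r = p (r % k) by rw [this]; exact hpdeg _
    apply Polynomial.eq_of_infinite_eval_eq
    have hinj : Function.Injective fun j : ℕ => ((r + j * (k' * k) : ℕ) : ℚ) := by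
      intro i j hij
      have h1 : r + i * (k' * k) = r + j * (k' * k) := Nat.cast_injective hij
      have h2 : 0 < k' * k := Nat.mul_pos hq.1 hk
      exact Nat.eq_of_mul_eq_mul_right h2 (Nat.add_left_cancel h1)
    refine (Set.infinite_range_of_injective hinj).mono ?_
    rintro _ ⟨j, rfl⟩
    have h1 := hq.2 r hr (r + j * (k' * k)) (by
      rw [Nat.ModEq, show j * (k' * k) = j * k * k' by ring, Nat.add_mul_mod_self_right])
    have h2 : (r + j * (k' * k)) % k = r % k := by
      rw [← mul_assoc, Nat.add_mul_mod_self_right]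
    rw [Set.mem_ofPred_eq, ← h1]
    simp only [hg, h2]
  · have hall : ∀ᶠ t in atTop, ∀ r ∈ Finset.range k, t ≡ r [MOD k] → F t = F k * (t / k) + c r :=
      (Finset.eventually_all _).2 fun r hr => hc r (Finset.mem_range.1 hr)
    filter_upwards [hall] with t ht
    have h1 := ht (t % k) (Finset.mem_range.2 (Nat.mod_lt _ hk)) (Nat.mod_modEq t k).symm
    have h2 : (t : ℚ) = (t % k : ℕ) + k * (t / k : ℕ) := by exact_mod_cast (Nat.mod_add_div t k).symm
    simp only [hg, hp, h1]
    simp only [Polynomial.eval_add, Polynomial.eval_mul, Polynomial.eval_C, Polynomial.eval_X]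
    push_cast
    generalize ((t / k : ℕ) : ℚ) = y at *
    generalize ((t % k : ℕ) : ℚ) = z at *
    rw [h2]
    field_simp
    ring

/-! ### From Minkowski sums to zonotopes -/

theorem IsLatticePolytope.convex {d : ℕ} {P : Set (Fin d → ℝ)} (hP : IsLatticePolytope P) :
    Convex ℝ P := by
  obtain ⟨V, -, rfl⟩ := hP
  exact convex_convexHull ℝ _

theorem IsLatticePolytope.exists_ne {d : ℕ} {Q : Set (Fin d → ℝ)} (hQ : IsLatticePolytope Q)
    (hdim : 0 < affDim Q) :
    ∃ a b : Fin d → ℤ, a ≠ b ∧ latticeHom d a ∈ Q ∧ latticeHom d b ∈ Q := by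
  obtain ⟨V, ⟨a, ha⟩, rfl⟩ := hQ
  have hmem : ∀ v ∈ V, latticeHom d v ∈ convexHull ℝ
      ((fun (v : Fin d → ℤ) (i : Fin d) => (v i : ℝ)) '' (V : Set (Fin d → ℤ))) :=
    fun v hv => subset_convexHull ℝ _ ⟨v, hv, rfl⟩
  by_contra! hcon
  have hV : (V : Set (Fin d → ℤ)) = {a} := by
    ext b
    refine ⟨fun hb => ?_, fun hb => hb ▸ ha⟩
    by_contra hne
    exact hcon a b (Ne.symm hne) (hmem a ha) (hmem b hb)
  rw [affDim, hV, Set.image_singleton, convexHull_singleton, vectorSpan_singleton,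
    finrank_bot] at hdim
  exact hdim.false

theorem isLatticePolytope_segment {d : ℕ} (p v : Fin d → ℤ) :
    IsLatticePolytope (convexHull ℝ {latticeHom d p, latticeHom d (p + v)}) := by
  classical
  refine ⟨{p, p + v}, by simp, ?_⟩
  rw [Finset.coe_pair, Set.image_pair]
  rfl

theorem affDim_segment_pos {d : ℕ} (p : Fin d → ℤ) {v : Fin d → ℤ} (hv : v ≠ 0) :
    0 < affDim (convexHull ℝ {latticeHom d p, latticeHom d (p + v)}) := by
  rw [affDim, Module.finrank_pos_iff, Submodule.nontrivial_iff_ne_bot, Submodule.ne_bot_iff]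
  refine ⟨latticeHom d v, ?_, fun h => hv (latticeHom_injective d (by rw [h, map_zero]))⟩
  have := vsub_mem_vectorSpan ℝ
    (subset_convexHull ℝ {latticeHom d p, latticeHom d (p + v)} (Or.inr rfl))
    (subset_convexHull ℝ {latticeHom d p, latticeHom d (p + v)} (Or.inl rfl))
  simpa using this

/-- Reduction of Minkowski decompositions to zonotopes. -/
theorem hasDecompositionOfDim_iff {d : ℕ} {P : Set (Fin d → ℝ)} (hP : IsLatticePolytope P)
    {ι : Type} {u : ι → (Fin d → ℤ) →+ ℤ} {h : ι → ℤ}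
    (hmem : ∀ (t : ℕ) (y : Fin d → ℤ),
      latticeHom d y ∈ (t : ℝ) • P ↔ ∀ j, 0 ≤ u j y + t * h j)
    (n t : ℕ) {m : ℕ} (hm : m ≠ 0) :
    HasDecompositionOfDim n ((t : ℝ) • P) m ↔ ∃ s : Multiset (Fin d → ℤ), s.card = m ∧ 0 ∉ s ∧
      Fits u h t s ∧ SpanLE n {v | v ∈ s} := by
  classical
  constructor
  · rintro ⟨Q, hQ, hsub, hdim⟩
    choose a b hab ha hb using fun i => (hQ i).1.exists_ne (hQ i).2
    have hpt : ∀ q : Fin m → Fin d → ℤ, (∀ i, q i = a i ∨ q i = b i) →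
        latticeHom d (∑ i, q i) ∈ ∑ i, Q i := fun q hq => by
      rw [map_sum]
      refine Set.finsetSum_mem_finsetSum _ _ _ fun i _ => ?_
      rcases hq i with h | h <;> rw [h]
      exacts [ha i, hb i]
    refine ⟨Finset.univ.val.map fun i => b i - a i, by simp, ?_, ⟨∑ i, a i, fun j => ?_⟩,
      vectorSpan ℝ (∑ i, Q i), hdim, ?_⟩
    · intro h0
      obtain ⟨i, -, hi⟩ := Multiset.mem_map.1 h0
      exact hab i (sub_eq_zero.1 hi).symm
    · have h1 := (hmem t _).1 (hsub (hpt (fun i => if u j (b i - a i) < 0 then b i else a i)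
        fun i => by split_ifs; exacts [Or.inr rfl, Or.inl rfl])) j
      have h2 : (((Finset.univ.val.map fun i => b i - a i).map (depth u j)).sum : ℤ) =
          ∑ i, (depth u j (b i - a i) : ℤ) := by
        rw [Multiset.map_map, ← Nat.cast_sum]
        rfl
      have h3 : ∀ i, u j (if u j (b i - a i) < 0 then b i else a i) =
          u j (a i) - depth u j (b i - a i) := fun i => by
        simp only [depth]
        rw [map_sub]
        split_ifs <;> omega
      rw [map_sum, Finset.sum_congr rfl fun i _ => h3 i, Finset.sum_sub_distrib] at h1
      rw [h2, map_sum]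
      linarith
    · intro v hv
      obtain ⟨i, -, rfl⟩ := Multiset.mem_map.1
        (show v ∈ Finset.univ.val.map fun i => b i - a i from hv)
      -- Exchanging a single endpoint exhibits `b i - a i` as a difference of two points of the sum.
      have h1 := vsub_mem_vectorSpan ℝ
        (hpt (fun k => if k = i then b k else a k) fun k => by by_cases hk : k = i <;> simp [hk])
        (hpt a fun k => Or.inl rfl)
      have h2 : latticeHom d (∑ k, if k = i then b k else a k) -ᵥ latticeHom d (∑ k, a k) =
          latticeHom d (b i - a i) := by
        rw [vsub_eq_sub, ← map_sub, ← Finset.sum_sub_distrib]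
        congr 1
        rw [Finset.sum_eq_single i] <;> simp +contextual
      rwa [h2] at h1
  · rintro ⟨s, rfl, h0, ⟨a, ha⟩, W, hW, hsW⟩
    obtain ⟨l, rfl⟩ := Quot.exists_rep s
    change (l : Multiset (Fin d → ℤ)).card ≠ 0 at hm
    change HasDecompositionOfDim n _ (l : Multiset (Fin d → ℤ)).card
    rw [Multiset.coe_card] at hm ⊢
    set v : Fin l.length → Fin d → ℤ := l.get with hv
    have hl : ∀ i, v i ∈ l := fun i => l.get_mem i
    -- The translation `a` is carried by the first segment, so `m ≠ 0` is needed; the empty sum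
    -- `{0}` need not lie in `tP`.
    set p : Fin l.length → Fin d → ℤ := fun i => if i = ⟨0, Nat.pos_of_ne_zero hm⟩ then a else 0
    have hp : ∑ i, p i = a := by simp [p]
    have hlatt : ∀ y ∈ ∑ i, ({latticeHom d (p i), latticeHom d (p i + v i)} : Set (Fin d → ℝ)),
        ∃ q : Fin l.length → Fin d → ℤ, (∀ i, q i = p i ∨ q i = p i + v i) ∧
          y = latticeHom d (∑ i, q i) := by
      intro y hy
      obtain ⟨g, hg, rfl⟩ := Set.mem_finsetSum _ _ _ |>.1 hy
      have hex : ∀ i, ∃ q, (q = p i ∨ q = p i + v i) ∧ g i = latticeHom d q := fun i => by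
        rcases hg (Finset.mem_univ i) with h | h
        exacts [⟨_, Or.inl rfl, h⟩, ⟨_, Or.inr rfl, h⟩]
      choose q hq hgq using hex
      exact ⟨q, hq, by rw [map_sum]; exact Finset.sum_congr rfl fun i _ => hgq i⟩
    refine ⟨fun i => convexHull ℝ {latticeHom d (p i), latticeHom d (p i + v i)}, fun i =>
      ⟨isLatticePolytope_segment _ _, affDim_segment_pos _ fun h => h0 (h ▸ hl i)⟩, ?_, ?_⟩
    · rw [← convexHull_sum]
      refine convexHull_min (fun y hy => ?_) (hP.convex.smul _)
      obtain ⟨q, hq, rfl⟩ := hlatt y hy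
      refine (hmem t _).2 fun j => ?_
      have h1 := ha j
      have h2 : ((Multiset.map (depth u j) (l : Multiset (Fin d → ℤ))).sum : ℤ) =
          ∑ i, (depth u j (v i) : ℤ) := by
        rw [Multiset.map_coe, Multiset.sum_coe, ← Nat.cast_sum, ← Fin.sum_ofFn]
        congr 2
        conv_lhs => rw [← List.ofFn_get l, List.map_ofFn]
        rfl
      change ((Multiset.map (depth u j) (l : Multiset (Fin d → ℤ))).sum : ℤ) ≤ _ at h1
      rw [h2, ← hp, map_sum] at h1
      have h3 : ∑ i, (u j (p i) - depth u j (v i)) ≤ ∑ i, u j (q i) := by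
        refine Finset.sum_le_sum fun i _ => ?_
        simp only [depth]
        rcases hq i with h | h <;> rw [h]
        · omega
        · rw [map_add]; omega
      rw [Finset.sum_sub_distrib] at h3
      rw [map_sum]
      linarith
    · refine le_trans (Submodule.finrank_mono ?_) hW
      have hsubW : ∀ y ∈ ∑ i, convexHull ℝ {latticeHom d (p i), latticeHom d (p i + v i)},
          y - latticeHom d a ∈ W := by
        intro y hy
        rw [← convexHull_sum] at hy
        have hconv : Convex ℝ {y | y - latticeHom d a ∈ W} := by
          have := W.convex.translate_preimage_left (-latticeHom d a)
          simpa [Set.preimage, sub_eq_add_neg] using this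
        refine convexHull_min (fun y hy => ?_) hconv hy
        obtain ⟨q, hq, rfl⟩ := hlatt y hy
        change latticeHom d (∑ i, q i) - latticeHom d a ∈ W
        rw [← hp, ← map_sub, ← Finset.sum_sub_distrib, map_sum]
        refine W.sum_mem fun i _ => ?_
        rcases hq i with h | h <;> rw [h]
        · simp
        · simpa using hsW _ (hl i)
      rw [vectorSpan_def, Submodule.span_le]
      rintro _ ⟨x, hx, y, hy, rfl⟩
      have := W.sub_mem (hsubW x hx) (hsubW y hy)
      simpa using this

theorem hasDecompositionOfDim_self_iff {d : ℕ} (P : Set (Fin d → ℝ)) (m : ℕ) :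
    HasDecompositionOfDim d P m ↔ HasDecomposition P m := by
  constructor
  · rintro ⟨Q, hQ, hsub, -⟩
    exact ⟨Q, hQ, hsub⟩
  · rintro ⟨Q, hQ, hsub⟩
    exact ⟨Q, hQ, hsub, (Submodule.finrank_le _).trans (by simp)⟩

theorem nthMinkowskiLength_self {d : ℕ} (P : Set (Fin d → ℝ)) :
    nthMinkowskiLength d P = minkowskiLength P := by
  simp only [nthMinkowskiLength, minkowskiLength, hasDecompositionOfDim_self_iff]

theorem SpanLE.of_self {d : ℕ} (A : Set (Fin d → ℤ)) : SpanLE d A :=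
  ⟨⊤, (Submodule.finrank_le _).trans (by simp), fun _ _ => Submodule.mem_top⟩

/-! ### Growth of the Minkowski lengths and the theorem -/

/-- The sequence `L_n(tP)` is finite, attains its largest slope, and grows at that slope; if
`n = d`, it is superadditive. -/
theorem nthMinkowskiLength_growth {d : ℕ} {P : Set (Fin d → ℝ)} (hP : IsLatticePolytope P)
    (n : ℕ) :
    (∀ t : ℕ, BddAbove {m | HasDecompositionOfDim n ((t : ℝ) • P) m}) ∧
    (∃ k : ℕ, 1 ≤ k ∧
      (∀ t : ℕ, nthMinkowskiLength n ((t : ℝ) • P) * k ≤ nthMinkowskiLength n ((k : ℝ) • P) * t) ∧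
      (∀ᶠ t : ℕ in atTop, nthMinkowskiLength n ((t : ℝ) • P) +
        nthMinkowskiLength n ((k : ℝ) • P) ≤ nthMinkowskiLength n (((t + k : ℕ) : ℝ) • P)) ∧
      ∀ r j : ℕ, j * nthMinkowskiLength n ((k : ℝ) • P) ≤
        nthMinkowskiLength n (((r + j * k : ℕ) : ℝ) • P)) ∧
    (n = d → ∀ s t : ℕ, nthMinkowskiLength n ((s : ℝ) • P) + nthMinkowskiLength n ((t : ℝ) • P) ≤
      nthMinkowskiLength n (((s + t : ℕ) : ℝ) • P)) := by
  obtain ⟨ι, _, u, h, C, hmem, hC, hneg, hne⟩ := hP.exists_inequalities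
  have hiff := fun t m (hm : m ≠ 0) => hasDecompositionOfDim_iff hP hmem n t (m := m) hm
  have hbdd : ∀ t : ℕ, BddAbove {m | HasDecompositionOfDim n ((t : ℝ) • P) m} := fun t => by
    refine ⟨Fintype.card ι * C * t, fun m hm => ?_⟩
    rcases eq_or_ne m 0 with rfl | hm0
    · exact Nat.zero_le _
    · obtain ⟨s, rfl, h0, hs, -⟩ := (hiff t m hm0).1 hm
      exact hs.card_le hC hneg h0
  set F : ℕ → ℕ := fun t => nthMinkowskiLength n ((t : ℝ) • P) with hF
  have hcard : ∀ t s, 0 ∉ s → Fits u h t s → SpanLE n {v | v ∈ s} → s.card ≤ F t := by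
    intro t s h0 hs hspan
    rcases eq_or_ne s.card 0 with hs0 | hs0
    · rw [hs0]; exact Nat.zero_le _
    · exact le_csSup (hbdd t) ((hiff t _ hs0).2 ⟨s, rfl, h0, hs, hspan⟩)
  have hatt : ∀ t, ∃ s, s.card = F t ∧ 0 ∉ s ∧ Fits u h t s ∧ SpanLE n {v | v ∈ s} := by
    intro t
    rcases eq_or_ne (F t) 0 with hF0 | hF0
    -- The empty multiset fits because every `tP` contains a lattice point.
    · exact ⟨0, by simp [hF0], by simp, fits_zero hne t, ⊥, by simp, by simp⟩
    · refine (hiff t _ hF0).1 (Nat.sSup_mem ?_ (hbdd t))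
      by_contra hemp
      rw [Set.not_nonempty_iff_eq_empty] at hemp
      exact hF0 (by simp [hF, nthMinkowskiLength, hemp])
  refine ⟨hbdd, ?_, ?_⟩
  · obtain ⟨𝒱, hfin, h𝒱, hred⟩ := exists_finite_families u h n
    have := hfin.fintype
    have hmax : ∀ (V : 𝒱) (t : ℕ), ∃ N, (∃ s, (∀ v ∈ s, v ∈ V.1) ∧ Fits u h t s ∧ s.card = N) ∧
        ∀ s, (∀ v ∈ s, v ∈ V.1) → Fits u h t s → s.card ≤ N := by
      intro V t
      set A : Set ℕ := {N | ∃ s, (∀ v ∈ s, v ∈ V.1) ∧ Fits u h t s ∧ s.card = N}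
      have hAne : A.Nonempty := ⟨0, show ∃ s, _ from ⟨0, by simp, fits_zero hne t, rfl⟩⟩
      have hA : BddAbove A := by
        refine ⟨Fintype.card ι * C * t, ?_⟩
        rintro _ ⟨s, hsV, hs, rfl⟩
        exact hs.card_le hC hneg fun h0 => (h𝒱 V.1 V.2).1 (hsV 0 h0)
      exact ⟨sSup A, Nat.sSup_mem hAne hA,
        fun s hsV hs => le_csSup hA ⟨s, hsV, hs, rfl⟩⟩
    choose f hf hfmax using hmax
    refine exists_slope_of_max_superadditive f ?_ ?_ F ?_ ?_
    · intro V s t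
      obtain ⟨a, haV, ha, ha'⟩ := hf V s
      obtain ⟨b, hbV, hb, hb'⟩ := hf V t
      rw [← ha', ← hb', ← Multiset.card_add]
      refine hfmax V _ _ (fun v hv => ?_) (ha.add hb)
      exact (Multiset.mem_add.1 hv).elim (haV v) (hbV v)
    · intro V
      obtain ⟨k, s₀, hk, hs₀V, hs₀, hmax⟩ :=
        exists_maximal_ratio hC hneg hne (h𝒱 V.1 V.2).1
      refine ⟨k, hk, fun t => ?_⟩
      obtain ⟨s, hsV, hs, hs'⟩ := hf V t
      rw [← hs']
      exact (hmax t s hsV hs).trans (Nat.mul_le_mul_right _ (hfmax V k s₀ hs₀V hs₀))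
    · intro V t
      obtain ⟨s, hsV, hs, hs'⟩ := hf V t
      obtain ⟨h0, W, hW, hVW⟩ := h𝒱 V.1 V.2
      rw [← hs']
      exact hcard t s (fun h => h0 (hsV 0 h)) hs ⟨W, hW, fun v hv => hVW v (hsV v hv)⟩
    · intro t
      obtain ⟨s, hst, h0, hs, hspan⟩ := hatt t
      obtain ⟨V, hV, s', hs'c, hs'V, hs'⟩ := hred t s h0 hs hspan
      refine ⟨⟨V, hV⟩, le_antisymm ?_ ?_⟩
      · rw [← hst, ← hs'c]
        exact hfmax ⟨V, hV⟩ t s' hs'V hs'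
      · obtain ⟨r, hrV, hr, hr'⟩ := hf ⟨V, hV⟩ t
        obtain ⟨h0, W, hW, hVW⟩ := h𝒱 V hV
        rw [← hr']
        exact hcard t r (fun h => h0 (hrV 0 h)) hr ⟨W, hW, fun v hv => hVW v (hrV v hv)⟩
  -- For `n = d` the rank bound is void, so optimal zonotopes can be added; for smaller `n` their
  -- sum may have too large a rank.
  · rintro rfl s t
    obtain ⟨a, ha', ha0, ha, -⟩ := hatt s
    obtain ⟨b, hb', hb0, hb, -⟩ := hatt t
    change F s + F t ≤ F (s + t)
    rw [← ha', ← hb', ← Multiset.card_add]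
    exact hcard _ _ (fun h => (Multiset.mem_add.1 h).elim ha0 hb0) (ha.add hb) (SpanLE.of_self _)

theorem isGreatest_slope {F : ℕ → ℕ} {k : ℕ} (hk : 1 ≤ k) (hslope : ∀ t, F t * k ≤ F k * t) :
    IsGreatest {x : ℝ | ∃ t : ℕ, 1 ≤ t ∧ x = (F t : ℝ) / (t : ℝ)} ((F k : ℝ) / k) := by
  refine ⟨⟨k, hk, rfl⟩, ?_⟩
  rintro _ ⟨t, ht, rfl⟩
  rw [div_le_div_iff₀ (by exact_mod_cast ht) (by exact_mod_cast hk)]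
  exact_mod_cast hslope t

/-- Transfers the slope inequality to the least period; `t = 0` is not covered by the supremum,
hence `h0`. -/
theorem slope_of_isLUB {F : ℕ → ℕ} (h0 : F 0 = 0) {k : ℕ} (hk : 1 ≤ k) {x : ℝ}
    (hx : IsLUB {x : ℝ | ∃ t : ℕ, 1 ≤ t ∧ x = (F t : ℝ) / (t : ℝ)} x) (hxk : x = (F k : ℝ) / k)
    (t : ℕ) : F t * k ≤ F k * t := by
  rcases Nat.eq_zero_or_pos t with rfl | ht
  · simp [h0]
  · have h1 := hx.1 ⟨t, ht, rfl⟩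
    rw [hxk, div_le_div_iff₀ (by exact_mod_cast ht) (by exact_mod_cast hk)] at h1
    exact_mod_cast h1

theorem theoremT {d : ℕ} (P : Set (Fin d → ℝ)) (hP : IsLatticePolytope P) :
    -- the (rational) Minkowski lengths are finite
    (∀ t : ℕ, BddAbove {m : ℕ | HasDecomposition ((t : ℝ) • P) m}) ∧
    BddAbove {x : ℝ | ∃ t : ℕ, 1 ≤ t ∧ x = (minkowskiLength ((t : ℝ) • P) : ℝ) / (t : ℝ)} ∧
    -- the period exists, and `L(tP)` is eventually quasi-linear with period at most `k`
    (∃ k : ℕ, IsPeriodOf P k ∧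
      EventuallyQuasiLinear (fun t : ℕ => (minkowskiLength ((t : ℝ) • P) : ℚ)) k ∧
      ∃ c : ℕ → ℤ, ∀ r < k,
        (minkowskiLength ((r : ℝ) • P) : ℝ) ≤ (c r : ℝ) ∧
        (c r : ℝ) ≤ (r : ℝ) * rationalMinkowskiLength P ∧
        ∀ᶠ t : ℕ in atTop, t ≡ r [MOD k] →
          (minkowskiLength ((t : ℝ) • P) : ℝ) =
            (k : ℝ) * rationalMinkowskiLength P * ((t / k : ℕ) : ℝ) + (c r : ℝ)) ∧
    -- eventual quasi-linearity of each `n`-th Minkowski length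
    (∀ n : ℕ, 1 ≤ n → n ≤ d → ∃ k : ℕ, 1 ≤ k ∧
      nthRationalMinkowskiLength n P = (nthMinkowskiLength n ((k : ℝ) • P) : ℝ) / (k : ℝ) ∧
      EventuallyQuasiLinear (fun t : ℕ => (nthMinkowskiLength n ((t : ℝ) • P) : ℚ)) k ∧
      ∃ c : ℕ → ℤ, ∀ r < k,
        0 ≤ c r ∧
        (c r : ℝ) ≤ (r : ℝ) * nthRationalMinkowskiLength n P ∧
        ∀ᶠ t : ℕ in atTop, t ≡ r [MOD k] →
          (nthMinkowskiLength n ((t : ℝ) • P) : ℝ) =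
            (k : ℝ) * nthRationalMinkowskiLength n P * ((t / k : ℕ) : ℝ) + (c r : ℝ)) := by
  have explicit : ∀ (F : ℕ → ℕ) (k : ℕ) (x : ℝ) (b c : ℕ → ℕ), 1 ≤ k → x = (F k : ℝ) / k →
      (∀ r < k, b r ≤ c r ∧ c r * k ≤ r * F k ∧
        ∀ᶠ t in atTop, t ≡ r [MOD k] → F t = F k * (t / k) + c r) →
      ∀ r < k, (b r : ℝ) ≤ ((c r : ℤ) : ℝ) ∧ ((c r : ℤ) : ℝ) ≤ r * x ∧
        ∀ᶠ t : ℕ in atTop, t ≡ r [MOD k] →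
          (F t : ℝ) = k * x * ((t / k : ℕ) : ℝ) + ((c r : ℤ) : ℝ) := by
    intro F k x b c hk hx hc r hr
    obtain ⟨h1, h2, h3⟩ := hc r hr
    have hk0 : (0 : ℝ) < k := by exact_mod_cast hk
    refine ⟨by exact_mod_cast h1, ?_, ?_⟩
    · rw [hx, ← mul_div_assoc, le_div_iff₀ hk0]
      exact_mod_cast h2
    · filter_upwards [h3] with t ht htr
      rw [ht htr, hx, mul_div_cancel₀ _ hk0.ne']
      push_cast
      ring
  obtain ⟨hbdd, ⟨k₀, hk₀, hslope₀, -, -⟩, hsup⟩ := nthMinkowskiLength_growth hP d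
  replace hsup := hsup rfl
  simp only [nthMinkowskiLength_self, hasDecompositionOfDim_self_iff] at hbdd hslope₀ hsup
  set F : ℕ → ℕ := fun t => minkowskiLength ((t : ℝ) • P) with hF
  have hgr := isGreatest_slope (F := F) hk₀ hslope₀
  have hlam : rationalMinkowskiLength P = (F k₀ : ℝ) / k₀ := hgr.csSup_eq
  have hF0 : F 0 = 0 := by
    have := hslope₀ 0
    simp only [mul_zero, Nat.le_zero, mul_eq_zero] at this
    exact this.resolve_right (by omega)
  refine ⟨hbdd, hgr.bddAbove, ?_, ?_⟩
  · classical
    have hex : ∃ k, 1 ≤ k ∧ rationalMinkowskiLength P = (F k : ℝ) / k := ⟨k₀, hk₀, hlam⟩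
    obtain ⟨k, ⟨hk, hkl⟩, hleast⟩ : ∃ k, IsPeriodOf P k :=
      ⟨Nat.find hex, Nat.find_spec hex, fun m hm => Nat.find_min' hex hm⟩
    have hslope := slope_of_isLUB hF0 hk (hlam ▸ hgr.isLUB) hkl
    -- Superadditivity permits `b = F`, which yields `L(rP) ≤ c r`; for general `n` below only `b =
    -- 0` is available.
    obtain ⟨c, hc⟩ := exists_eventually_eq_mul_div_add F hk hslope
      (Eventually.of_forall fun t => hsup t k) F fun r j => by
        have h1 := superadditive_mul_le hsup j k
        have h2 := hsup r (j * k)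
        simp only [hF] at *
        omega
    exact ⟨k, ⟨⟨hk, hkl⟩, hleast⟩,
      eventuallyQuasiLinear_of_eq (F := F) hk fun r hr => (hc r hr).2.2,
      fun r => c r, explicit F k _ F c hk hkl hc⟩
  · intro n _ _
    obtain ⟨-, ⟨k, hk, hslope, hmono, hgrow⟩, -⟩ := nthMinkowskiLength_growth hP n
    set G : ℕ → ℕ := fun t => nthMinkowskiLength n ((t : ℝ) • P) with hG
    have hkl : nthRationalMinkowskiLength n P = (G k : ℝ) / k :=
      (isGreatest_slope (F := G) hk hslope).csSup_eq
    obtain ⟨c, hc⟩ := exists_eventually_eq_mul_div_add G hk hslope hmono (fun _ => 0)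
      fun r j => (Nat.zero_add _).trans_le (hgrow r j)
    exact ⟨k, hk, hkl, eventuallyQuasiLinear_of_eq (F := G) hk fun r hr => (hc r hr).2.2,
      fun r => c r, fun r hr => ⟨Int.natCast_nonneg _, (explicit G k _ _ c hk hkl hc r hr).2⟩⟩
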